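/- Let $D$ be a real diagonal $n\times n$ matrix, let $T\ge 0$, and let $\mathbb S^n_{++}$ be the set of real symmetric positive definite $n\times n$ matrices. For $\Sigma_0\in\mathbb S^n_{++}$, let $\mathcal R(\Sigma_0,D,T)$ be the set of all $\Sigma_T\in\mathbb S^n_{++}$ for which there are a measurable map $t\mapsto U_t\in O(n)$ on $[0,T]$ and an absolutely continuous path $t\mapsto\Sigma_t$ of $n\times n$ matrices on $[0,T]$ that starts at $\Sigma_0$, ends at $\Sigma_T$, and satisfies $$\dot\Sigma_t=A_t\Sigma_t+\Sigma_tA_t,\qquad A_t=U_tDU_t^\top,$$ for almost every $t\in[0,T]$. For $x,y\in\mathbb R^n$ write $x\prec y$ ($x$ is majorized by $y$) if $\sum_{i=1}^n x_i=\sum_{i=1}^n y_i$ and $\sum_{i=1}^k x^\downarrow_i\le\sum_{i=1}^k y^\downarrow_i$ for all $1\le k\le n-1$, where $x^\downarrow$ is the vector $x$ with its entries rearranged in decreasing order. Let $\boldsymbol\lambda_D$ be the vector of eigenvalues of $D$, let $\log\boldsymbol\lambda_T$ be the vector of logarithms of the eigenvalues of $\Sigma_T$ (that is, of the eigenvalues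 of $\log\Sigma_T$), in both cases with multiplicity, and let $\mathbf 1=(1,\dots,1)$. Then, for every $c>0$, $$\mathcal R(cI,D,T)=\{\Sigma_T\in\mathbb S^n_{++} : \log\boldsymbol\lambda_T\prec(\log c)\mathbf 1+2T\boldsymbol\lambda_D\}.$$ -/

import Mathlib

/-- The decreasing rearrangement of a real vector. -/
noncomputable def decreasingRearrangement {n : ℕ} (x : Fin n → ℝ) : Fin n → ℝ :=
  fun i => x (Tuple.sort x i.rev)

/-- `IsMajorizedBy x y` is the majorization relation `x ≺ y`: the entries of `x` and `y` have the same
sum, and for `1 ≤ k ≤ n - 1` the sum of the `k` largest entries of `x` is at most the sum of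
the `k` largest entries of `y`. -/
def IsMajorizedBy {n : ℕ} (x y : Fin n → ℝ) : Prop :=
  ∑ i, x i = ∑ i, y i ∧
    ∀ k : ℕ, 1 ≤ k → k < n →
      ∑ i : Fin n with i.val < k, decreasingRearrangement x i ≤
        ∑ i : Fin n with i.val < k, decreasingRearrangement y i

/-- `S` solves the differential Lyapunov equation `S' = A S + S A` on `[0, T]` in the sense of
Carathéodory: it is absolutely continuous and satisfies the equation almost everywhere. -/
def IsLyapunovSolution {n : ℕ} (A S : ℝ → Matrix (Fin n) (Fin n) ℝ) (T : ℝ) : Prop :=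
  (∀ i j, AbsolutelyContinuousOnInterval (fun t => S t i j) 0 T) ∧
    ∀ᵐ t ∂(MeasureTheory.volume.restrict (Set.Icc 0 T)), ∀ i j,
      HasDerivAt (fun s => S s i j) ((A t * S t + S t * A t) i j) t

/-- The positive definite matrices that are reached from `S₀` at time `T` along
`S' = A S + S A` with `A t = U t * D * (U t)ᵀ`, over all measurable orthogonal-matrix-valued
controls `U`. -/
def reachableSet {n : ℕ} (S₀ D : Matrix (Fin n) (Fin n) ℝ) (T : ℝ) :
    Set (Matrix (Fin n) (Fin n) ℝ) :=
  {S₁ | S₁.PosDef ∧ ∃ U S : ℝ → Matrix (Fin n) (Fin n) ℝ,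
    (∀ t ∈ Set.Icc 0 T, U t ∈ Matrix.orthogonalGroup (Fin n) ℝ) ∧
    (∀ i j, Measurable fun t => U t i j) ∧
    IsLyapunovSolution (fun t => U t * D * (U t).transpose) S T ∧
    S 0 = S₀ ∧ S T = S₁}

/-- A real diagonal matrix is symmetric. -/
theorem isHermitian_of_isDiag {n : ℕ} {D : Matrix (Fin n) (Fin n) ℝ} (hD : D.IsDiag) :
    D.IsHermitian := by
  rw [Matrix.IsHermitian, Matrix.conjTranspose_eq_transpose_of_trivial]
  exact hD.isSymm

/-! Necessity: let `G t` be the maximum of `det (Vᵀ * S t * V)` over orthonormal `k`-frames `V`. By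
Cauchy–Binet this is the product of the `k` largest eigenvalues, attained at an eigenframe. With
such a frame held fixed, the determinant has derivative `2 * tr (Vᵀ * A * V)` times itself, and Ky
Fan bounds that trace by the sum of the `k` largest eigenvalues of `D`. An envelope argument
(`IsLyapunovSolution.det_compression_le`) transfers the bound to `G` at almost every time, so no
regular choice of eigenvectors is needed, and Grönwall integrates it. Logarithms give the
majorization inequalities; Liouville's formula gives the equality of sums. Beforehand, every
solution is shown to be symmetric and positive definite.

Sufficiency: by Rado's theorem the target log-spectrum is an average, with weights `w σ`, of the
vectors `log c + 2 * T * d (σ i)`, where `d` is the spectrum of `D`. Keep `A` diagonal in the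
eigenbasis of the target and give its spectrum the order `σ` for a time `T * w σ`. As `c • 1` is
diagonal in every basis, everything commutes and the logarithms of the eigenvalues simply integrate
to the target. -/

/-! ### Majorization and Rado's theorem -/

theorem exists_perm_decreasingRearrangement {n : ℕ} (x : Fin n → ℝ) :
    ∃ e : Equiv.Perm (Fin n), ∀ i, decreasingRearrangement x i = x (e i) :=
  ⟨Fin.revPerm.trans (Tuple.sort x), fun _ => rfl⟩

theorem decreasingRearrangement_antitone {n : ℕ} (x : Fin n → ℝ) :
    Antitone (decreasingRearrangement x) := fun _ _ h =>
  Tuple.monotone_sort x (Fin.rev_le_rev.mpr h)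

/-- Weights between `0` and `1` of total mass `k` give at most the sum of the `k` largest
entries. -/
theorem sum_mul_le_sum_decreasingRearrangement {n k : ℕ} (hk : k ≤ n) (x w : Fin n → ℝ)
    (h0 : ∀ i, 0 ≤ w i) (h1 : ∀ i, w i ≤ 1) (hw : ∑ i, w i = k) :
    ∑ i, w i * x i ≤ ∑ i : Fin n with i.val < k, decreasingRearrangement x i := by
  obtain ⟨e, he⟩ := exists_perm_decreasingRearrangement x
  have hanti := decreasingRearrangement_antitone x
  rcases Nat.eq_zero_or_pos k with rfl | hpos
  · have hz : ∀ i, w i = 0 := by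
      intro i
      refine (Finset.sum_eq_zero_iff_of_nonneg fun i _ => h0 i).1 ?_ i (Finset.mem_univ i)
      simpa using hw
    simp [hz]
  -- The `k`-th largest entry serves as threshold: `(w - 1_{i<k}) * (x - τ) ≤ 0` entrywise after
  -- sorting. On summation the `τ` terms cancel, since both weights have mass `k`.
  let τ := decreasingRearrangement x ⟨k - 1, by omega⟩
  have hcard : ∑ i : Fin n, (if i.val < k then (1 : ℝ) else 0) = k := by
    rw [Finset.sum_boole]
    have := Fin.card_filter_val_lt (n := n) (m := k)
    rw [this, min_eq_right hk]
  rw [← Equiv.sum_comp e] at hw ⊢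
  rw [Finset.sum_filter]
  have key : ∀ i : Fin n, w (e i) * x (e i) + (if i.val < k then (1 : ℝ) else 0) * τ ≤
      (if i.val < k then decreasingRearrangement x i else 0) + w (e i) * τ := by
    intro i
    rw [← he i]
    have a0 := h0 (e i)
    have a1 := h1 (e i)
    split_ifs with hi
    · have : τ ≤ decreasingRearrangement x i := hanti (by
        rw [Fin.le_def]; simp only; omega)
      nlinarith
    · have : decreasingRearrangement x i ≤ τ := hanti (by
        rw [Fin.le_def]; simp only; omega)
      nlinarith
  have := Finset.sum_le_sum fun i (_ : i ∈ Finset.univ) => key i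
  rw [Finset.sum_add_distrib, Finset.sum_add_distrib, ← Finset.sum_mul, ← Finset.sum_mul, hw,
    hcard] at this
  linarith

theorem sum_comp_le_sum_decreasingRearrangement {n k : ℕ} (hk : k ≤ n) (x : Fin n → ℝ)
    (e : Equiv.Perm (Fin n)) :
    ∑ i : Fin n with i.val < k, x (e i) ≤
      ∑ i : Fin n with i.val < k, decreasingRearrangement x i := by
  have h := sum_mul_le_sum_decreasingRearrangement hk x
    (fun i => if (e.symm i).val < k then 1 else 0)
    (fun i => by split_ifs <;> norm_num) (fun i => by split_ifs <;> norm_num)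
    (by
      rw [← Equiv.sum_comp e]
      simp only [Equiv.symm_apply_apply]
      rw [Finset.sum_boole, Fin.card_filter_val_lt, min_eq_right hk])
  refine le_trans (le_of_eq ?_) h
  rw [← Equiv.sum_comp e, Finset.sum_filter]
  refine Finset.sum_congr rfl fun i _ => ?_
  simp only [Equiv.symm_apply_apply]
  split_ifs <;> simp

/-- Abel summation. Since the total of `u` vanishes, `a` needs no sign. -/
theorem sum_range_mul_nonneg_of_antitone (a u : ℕ → ℝ) (n : ℕ)
    (ha : ∀ i, i + 1 < n → a (i + 1) ≤ a i) (hu : ∀ k, k < n → 0 ≤ ∑ i ∈ Finset.range k, u i)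
    (h0 : ∑ i ∈ Finset.range n, u i = 0) : 0 ≤ ∑ i ∈ Finset.range n, a i * u i := by
  cases n with
  | zero => simp
  | succ n =>
    have : ∀ m, m ≤ n → a m * ∑ i ∈ Finset.range (m + 1), u i ≤
        ∑ i ∈ Finset.range (m + 1), a i * u i := by
      intro m
      induction m with
      | zero => simp
      | succ m ih =>
        intro hm
        rw [Finset.sum_range_succ _ (m + 1), Finset.sum_range_succ _ (m + 1), mul_add]
        have h1 := ih (by omega)
        have h2 := mul_le_mul_of_nonneg_right (ha m (by omega)) (hu (m + 1) (by omega))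
        linarith
    have := this n le_rfl
    rwa [h0, mul_zero] at this

theorem sum_filter_val_lt_eq_sum_range {n k : ℕ} (hk : k ≤ n) (u : Fin n → ℝ) :
    ∑ i : Fin n with i.val < k, u i =
      ∑ i ∈ Finset.range k, if h : i < n then u ⟨i, h⟩ else 0 := by
  rw [Finset.sum_filter]
  have : ∀ i : Fin n, (if i.val < k then u i else 0) =
      (fun j : ℕ => if j < k then (if h : j < n then u ⟨j, h⟩ else 0) else 0) i.val := by
    intro i
    simp
  rw [Finset.sum_congr rfl fun i _ => this i,
    Fin.sum_univ_eq_sum_range (fun j : ℕ => if j < k then (if h : j < n then u ⟨j, h⟩ else 0) else 0),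
    ← Finset.sum_filter]
  congr 1
  ext j
  simp only [Finset.mem_filter, Finset.mem_range]
  omega

theorem sum_mul_nonneg_of_antitone {n : ℕ} (a u : Fin n → ℝ) (ha : Antitone a)
    (hu : ∀ k, k < n → 0 ≤ ∑ i : Fin n with i.val < k, u i)
    (h0 : ∑ i, u i = 0) : 0 ≤ ∑ i, a i * u i := by
  have hall : ∀ v : Fin n → ℝ,
      ∑ i, v i = ∑ i ∈ Finset.range n, if h : i < n then v ⟨i, h⟩ else 0 := by
    intro v
    rw [← sum_filter_val_lt_eq_sum_range le_rfl]
    simp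
  have := sum_range_mul_nonneg_of_antitone (fun i => if h : i < n then a ⟨i, h⟩ else 0)
    (fun i => if h : i < n then u ⟨i, h⟩ else 0) n
    (fun i hi => by
      simp only [hi, Nat.lt_of_succ_lt hi, dite_true]
      exact ha (by simp [Fin.le_def]))
    (fun k hk => by
      rw [← sum_filter_val_lt_eq_sum_range hk.le]
      exact hu k hk)
    (by rw [← hall, h0])
  rw [hall]
  refine this.trans_eq (Finset.sum_congr rfl fun i hi => ?_)
  simp [Finset.mem_range.1 hi]

/-- Every linear functional is at least as large at some rearrangement of `y` as at a vector
majorized by `y`. -/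
theorem IsMajorizedBy.exists_perm_sum_mul_le {n : ℕ} {x y : Fin n → ℝ} (h : IsMajorizedBy x y)
    (a : Fin n → ℝ) :
    ∃ σ : Equiv.Perm (Fin n), ∑ i, a i * x i ≤ ∑ i, a i * y (σ i) := by
  obtain ⟨e, he⟩ := exists_perm_decreasingRearrangement a
  obtain ⟨p, hp⟩ := exists_perm_decreasingRearrangement y
  -- Pair the `i`-th largest entry of `a` with the `i`-th largest entry of `y`.
  refine ⟨e.symm.trans p, ?_⟩
  rw [← Equiv.sum_comp e, ← Equiv.sum_comp e fun i => a i * y ((e.symm.trans p) i)]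
  simp only [Equiv.trans_apply, Equiv.symm_apply_apply, ← he, ← hp]
  have := sum_mul_nonneg_of_antitone (decreasingRearrangement a)
    (fun i => decreasingRearrangement y i - x (e i)) (decreasingRearrangement_antitone a)
    (fun k hk => by
      rw [Finset.sum_sub_distrib, sub_nonneg]
      rcases Nat.eq_zero_or_pos k with rfl | hpos
      · simp
      · exact (sum_comp_le_sum_decreasingRearrangement hk.le x e).trans (h.2 k hpos hk))
    (by
      rw [Finset.sum_sub_distrib, Equiv.sum_comp e, h.1, sub_eq_zero]
      simp only [hp]
      exact Equiv.sum_comp p y)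
  simp only [mul_sub, Finset.sum_sub_distrib] at this
  linarith

/-- **Rado's theorem**: a vector majorized by `y` is a convex combination of the rearrangements
of `y`. -/
theorem IsMajorizedBy.exists_convex_combination {n : ℕ} {x y : Fin n → ℝ}
    (h : IsMajorizedBy x y) :
    ∃ w : Equiv.Perm (Fin n) → ℝ, (∀ σ, 0 ≤ w σ) ∧ ∑ σ, w σ = 1 ∧
      ∀ i, x i = ∑ σ, w σ * y (σ i) := by
  let L : (Equiv.Perm (Fin n) → ℝ) →L[ℝ] (Fin n → ℝ) :=
    ContinuousLinearMap.pi fun i => ∑ σ, (y (σ i)) • ContinuousLinearMap.proj σ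
  have hL : ∀ w i, L w i = ∑ σ, w σ * y (σ i) := by
    intro w i
    simp [L, mul_comm]
  by_cases hx : x ∈ L '' stdSimplex ℝ (Equiv.Perm (Fin n))
  · obtain ⟨w, hw, rfl⟩ := hx
    exact ⟨w, hw.1, hw.2, fun i => hL w i⟩
  -- The image of the simplex is the convex hull of the rearrangements of `y`. A functional strictly
  -- separating `x` from it would contradict `exists_perm_sum_mul_le`.
  exfalso
  obtain ⟨f, u, hf, hu⟩ := geometric_hahn_banach_closed_point
    ((convex_stdSimplex ℝ _).linear_image L.toLinearMap)
    ((isCompact_stdSimplex ℝ (Equiv.Perm (Fin n))).image L.continuous).isClosed hx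
  have hfsum : ∀ z : Fin n → ℝ, f z = ∑ i, f (Pi.single i 1) * z i := by
    intro z
    conv_lhs => rw [pi_eq_sum_univ' z, map_sum]
    refine Finset.sum_congr rfl fun i _ => ?_
    rw [map_smul, smul_eq_mul, mul_comm]
  obtain ⟨σ, hσ⟩ := h.exists_perm_sum_mul_le fun i => f (Pi.single i 1)
  have hmem : (fun i => y (σ i)) ∈ L '' stdSimplex ℝ (Equiv.Perm (Fin n)) :=
    ⟨Pi.single σ 1, single_mem_stdSimplex ℝ σ, by
      ext i
      simp [hL, Pi.single_apply]⟩
  have h1 := hf _ hmem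
  rw [hfsum] at h1 hu
  linarith

/-! ### Determinants and traces of compressions to orthonormal frames -/

open Matrix in
/-- The **Cauchy–Binet formula**, with the sum over all maps instead of over all subsets. -/
theorem Matrix.factorial_card_mul_det_mul {m n R : Type*} [Fintype m] [DecidableEq m] [Fintype n]
    [CommRing R] (A : Matrix m n R) (B : Matrix n m R) :
    ((Fintype.card m).factorial : R) * (A * B).det =
      ∑ f : m → n, (A.submatrix id f).det * (B.submatrix f id).det := by
  classical
  have expand : (A * B).det = ∑ f : m → n, (A.submatrix id f).det * ∏ i, B (f i) i := by
    simp only [det_apply', mul_apply, Finset.prod_univ_sum, Finset.mul_sum, Fintype.piFinset_univ,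
      submatrix_apply, id, Finset.sum_mul]
    rw [Finset.sum_comm]
    refine Finset.sum_congr rfl fun f _ => Finset.sum_congr rfl fun σ _ => ?_
    rw [Finset.prod_mul_distrib, mul_assoc]
  -- Replacing `f` by `f ∘ τ` costs a sign; averaging over all `τ` then assembles the second
  -- determinant.
  have perm : ∀ τ : Equiv.Perm m, (A * B).det =
      ∑ f : m → n, (A.submatrix id f).det *
        (((Equiv.Perm.sign τ : ℤ) : R) * ∏ i, B (f (τ i)) i) := by
    intro τ
    rw [expand, ← Equiv.sum_comp (Equiv.arrowCongr τ.symm (Equiv.refl n))]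
    refine Finset.sum_congr rfl fun f _ => ?_
    have h1 : A.submatrix id (Equiv.arrowCongr τ.symm (Equiv.refl n) f) =
        (A.submatrix id f).submatrix id τ := by
      ext i j
      simp [Equiv.arrowCongr]
    rw [h1, det_permute']
    simp [Equiv.arrowCongr]
    ring
  have card : ((Fintype.card m).factorial : R) * (A * B).det =
      ∑ _τ : Equiv.Perm m, (A * B).det := by
    rw [Finset.sum_const, Finset.card_univ, Fintype.card_perm, nsmul_eq_mul]
  rw [card, Finset.sum_congr rfl fun τ _ => perm τ, Finset.sum_comm]
  refine Finset.sum_congr rfl fun f _ => ?_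
  rw [← Finset.mul_sum, det_apply' (B.submatrix f id)]
  rfl

/-- The determinant of a compression to an orthonormal frame is at most the largest product of
distinct eigenvalues. -/
theorem Matrix.det_transpose_mul_mul_le {m n : Type*} [Fintype m] [DecidableEq m] [Fintype n]
    [DecidableEq n] {Q : Matrix n n ℝ} (hQ : Q * Q.transpose = 1) (d : n → ℝ)
    {p : ℝ} (hp : ∀ f : m → n, Function.Injective f → ∏ a, d (f a) ≤ p) {V : Matrix n m ℝ}
    (hV : V.transpose * V = 1) :
    (V.transpose * (Q * Matrix.diagonal d * Q.transpose) * V).det ≤ p := by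
  set W := Q.transpose * V with hWdef
  have hW : W.transpose * W = 1 := by
    rw [hWdef, Matrix.transpose_mul, Matrix.transpose_transpose, Matrix.mul_assoc,
      ← Matrix.mul_assoc Q, hQ, Matrix.one_mul, hV]
  have hrw : V.transpose * (Q * Matrix.diagonal d * Q.transpose) * V =
      W.transpose * (Matrix.diagonal d * W) := by
    simp only [hWdef, Matrix.transpose_mul, Matrix.transpose_transpose, Matrix.mul_assoc]
  -- By `h2` the squared minors of `W` have total mass `m!`, so `h1` presents the determinant as a
  -- weighted mean of the products `∏ a, d (f a)`. Non-injective `f` have weight zero, hence `hp`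
  -- suffices.
  have h1 := Matrix.factorial_card_mul_det_mul W.transpose (Matrix.diagonal d * W)
  have h2 := Matrix.factorial_card_mul_det_mul W.transpose W
  rw [hW, Matrix.det_one, mul_one] at h2
  rw [hrw]
  have hpos : (0 : ℝ) < ((Fintype.card m).factorial : ℝ) := by exact_mod_cast Nat.factorial_pos _
  refine le_of_mul_le_mul_left ?_ hpos
  rw [h1]
  conv_rhs => rw [h2]
  rw [Finset.sum_mul]
  refine Finset.sum_le_sum fun f _ => ?_
  have ht : (W.transpose.submatrix id f).det = (W.submatrix f id).det := by
    rw [← Matrix.transpose_submatrix, Matrix.det_transpose]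
  have hd : ((Matrix.diagonal d * W).submatrix f id).det =
      (∏ a, d (f a)) * (W.submatrix f id).det := by
    rw [← Matrix.det_diagonal, ← Matrix.det_mul]
    congr 1
    ext i j
    simp [Matrix.diagonal_mul]
  rw [ht, hd]
  by_cases hf : Function.Injective f
  · nlinarith [hp f hf, mul_self_nonneg (W.submatrix f id).det]
  · have : (W.submatrix f id).det = 0 := by
      rw [Function.Injective] at hf
      push Not at hf
      obtain ⟨i, j, hij, hne⟩ := hf
      exact Matrix.det_zero_of_row_eq hne (by ext l; simp [hij])
    simp [this]

/-- **Jacobi's formula** at a diagonal matrix. -/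
theorem Matrix.hasDerivAt_det_of_eq_diagonal {m : Type*} [Fintype m] [DecidableEq m]
    {M : ℝ → Matrix m m ℝ} {M' : Matrix m m ℝ} {t : ℝ} {d : m → ℝ}
    (hM : ∀ i j, HasDerivAt (fun s => M s i j) (M' i j) t) (ht : M t = Matrix.diagonal d) :
    HasDerivAt (fun s => (M s).det) (∑ a, (∏ b ∈ Finset.univ.erase a, d b) * M' a a) t := by
  simp only [Matrix.det_apply']
  have h1 : ∀ σ : Equiv.Perm m, HasDerivAt
      (fun s => ((Equiv.Perm.sign σ : ℤ) : ℝ) * ∏ i, M s (σ i) i)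
      (((Equiv.Perm.sign σ : ℤ) : ℝ) *
        ∑ a, (∏ b ∈ Finset.univ.erase a, M t (σ b) b) * M' (σ a) a) t := fun σ =>
    (HasDerivAt.fun_finsetProd fun i _ => hM (σ i) i).const_mul _
  refine (HasDerivAt.fun_sum fun σ (_ : σ ∈ Finset.univ) => h1 σ).congr_deriv ?_
  rw [Finset.sum_eq_single 1]
  · simp [ht]
  · intro σ _ hσ
    rw [Finset.sum_eq_zero, mul_zero]
    intro a _
    -- A non-identity permutation moves at least two points, so an off-diagonal zero remains after
    -- the factor at `a` is removed.
    have : ∃ b, b ≠ a ∧ σ b ≠ b := by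
      by_contra hcon
      push Not at hcon
      refine hσ (Equiv.ext fun b => ?_)
      by_cases hb : b = a
      · subst hb
        by_contra hne
        have := hcon (σ b) hne
        exact hne (σ.injective this)
      · exact hcon b hb
    obtain ⟨b, hba, hb⟩ := this
    rw [Finset.prod_eq_zero (Finset.mem_erase.2 ⟨hba, Finset.mem_univ b⟩), zero_mul]
    rw [ht, Matrix.diagonal_apply_ne _ hb]
  · simp

theorem Matrix.hasDerivAt_mul_mul_apply {m n : Type*} [Fintype n] {S : ℝ → Matrix n n ℝ}
    {S' : Matrix n n ℝ} {t : ℝ} (hS : ∀ i j, HasDerivAt (fun s => S s i j) (S' i j) t)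
    (W : Matrix m n ℝ) (V : Matrix n m ℝ) (i j : m) :
    HasDerivAt (fun s => (W * S s * V) i j) ((W * S' * V) i j) t := by
  simp only [Matrix.mul_apply]
  exact HasDerivAt.fun_sum fun p _ =>
    (HasDerivAt.fun_sum fun q _ => (hS q p).const_mul (W i q)).mul_const _

/-- Along `S' = A S + S A`, the determinant of the compression to an orthonormal frame of
eigenvectors has logarithmic derivative twice the trace of the compression of `A`. -/
theorem Matrix.hasDerivAt_det_compression {m n : Type*} [Fintype m] [DecidableEq m] [Fintype n]
    {S : ℝ → Matrix n n ℝ} {A : Matrix n n ℝ} {t : ℝ}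
    (hS : ∀ i j, HasDerivAt (fun s => S s i j) ((A * S t + S t * A) i j) t)
    (hsymm : (S t).transpose = S t) {V : Matrix n m ℝ} {d : m → ℝ} (hV : V.transpose * V = 1)
    (hVd : S t * V = V * Matrix.diagonal d) :
    HasDerivAt (fun s => (V.transpose * S s * V).det)
      (2 * (V.transpose * A * V).trace * (V.transpose * S t * V).det) t := by
  have hdiag : V.transpose * S t * V = Matrix.diagonal d := by
    rw [Matrix.mul_assoc, hVd, ← Matrix.mul_assoc, hV, Matrix.one_mul]
  have hVd' : V.transpose * S t = Matrix.diagonal d * V.transpose := by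
    have := congrArg Matrix.transpose hVd
    rwa [Matrix.transpose_mul, Matrix.transpose_mul, hsymm, Matrix.diagonal_transpose] at this
  refine (Matrix.hasDerivAt_det_of_eq_diagonal
    (Matrix.hasDerivAt_mul_mul_apply hS V.transpose V) hdiag).congr_deriv ?_
  have h : V.transpose * (A * S t + S t * A) * V =
      (V.transpose * A * V) * Matrix.diagonal d + Matrix.diagonal d * (V.transpose * A * V) := by
    rw [Matrix.mul_add, Matrix.add_mul, Matrix.mul_assoc, Matrix.mul_assoc A, hVd,
      ← Matrix.mul_assoc V.transpose (S t), hVd']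
    simp only [Matrix.mul_assoc]
  rw [h, hdiag, Matrix.det_diagonal, Matrix.trace, Finset.mul_sum, Finset.sum_mul]
  refine Finset.sum_congr rfl fun a _ => ?_
  rw [← Finset.mul_prod_erase Finset.univ d (Finset.mem_univ a), Matrix.add_apply,
    Matrix.mul_diagonal, Matrix.diagonal_mul, Matrix.diag_apply]
  ring

/-- The diagonal of the projection onto the span of an orthonormal frame is at most `1`. -/
theorem Matrix.sum_sq_row_le_one {m n : Type*} [Fintype m] [DecidableEq m] [Fintype n]
    {W : Matrix n m ℝ} (hW : W.transpose * W = 1) (j : n) : ∑ a, W j a ^ 2 ≤ 1 := by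
  set P := W * W.transpose with hP
  have hPP : P * P = P := by
    rw [hP, Matrix.mul_assoc, ← Matrix.mul_assoc W.transpose, hW, Matrix.one_mul]
  have hPT : P.transpose = P := by
    rw [hP, Matrix.transpose_mul, Matrix.transpose_transpose]
  have hPj : P j j = ∑ a, W j a ^ 2 := by
    simp [hP, Matrix.mul_apply, sq]
  -- For a symmetric idempotent, `P j j` is the sum of the squares of row `j`, one of which is `P j
  -- j ^ 2`.
  have hsq : P j j ^ 2 ≤ P j j := by
    have h1 : P j j = ∑ l, P j l ^ 2 := by
      conv_lhs => rw [← hPP, Matrix.mul_apply]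
      refine Finset.sum_congr rfl fun l _ => ?_
      rw [sq, ← Matrix.transpose_apply P, hPT]
    conv_rhs => rw [h1]
    exact Finset.single_le_sum (f := fun l => P j l ^ 2) (fun l _ => sq_nonneg _)
      (Finset.mem_univ j)
  rw [← hPj]
  nlinarith

/-- **Ky Fan's inequality** for the trace of a compression. -/
theorem Matrix.trace_compression_le {n k : ℕ} (hk : k ≤ n) {Q : Matrix (Fin n) (Fin n) ℝ}
    (hQ : Q * Q.transpose = 1) (d : Fin n → ℝ) {V : Matrix (Fin n) (Fin k) ℝ}
    (hV : V.transpose * V = 1) :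
    (V.transpose * (Q * Matrix.diagonal d * Q.transpose) * V).trace ≤
      ∑ i : Fin n with i.val < k, decreasingRearrangement d i := by
  set W := Q.transpose * V with hWdef
  have hW : W.transpose * W = 1 := by
    rw [hWdef, Matrix.transpose_mul, Matrix.transpose_transpose, Matrix.mul_assoc,
      ← Matrix.mul_assoc Q, hQ, Matrix.one_mul, hV]
  have hrw : V.transpose * (Q * Matrix.diagonal d * Q.transpose) * V =
      W.transpose * (Matrix.diagonal d * W) := by
    simp only [hWdef, Matrix.transpose_mul, Matrix.transpose_transpose, Matrix.mul_assoc]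
  have htr : (W.transpose * (Matrix.diagonal d * W)).trace = ∑ j, (∑ a, W j a ^ 2) * d j := by
    simp only [Matrix.trace, Matrix.diag_apply, Matrix.mul_apply (M := W.transpose),
      Matrix.diagonal_mul, Matrix.transpose_apply, Finset.sum_mul]
    rw [Finset.sum_comm]
    exact Finset.sum_congr rfl fun j _ => Finset.sum_congr rfl fun a _ => by ring
  rw [hrw, htr]
  refine sum_mul_le_sum_decreasingRearrangement hk d _
    (fun j => Finset.sum_nonneg fun a _ => sq_nonneg _) (Matrix.sum_sq_row_le_one hW) ?_
  have : (W.transpose * W).trace = k := by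
    rw [hW, Matrix.trace_one, Fintype.card_fin]
  rw [← this]
  simp only [Matrix.trace, Matrix.diag_apply, Matrix.mul_apply, Matrix.transpose_apply]
  rw [Finset.sum_comm]
  exact Finset.sum_congr rfl fun j _ => Finset.sum_congr rfl fun a _ => by ring

theorem Matrix.IsHermitian.exists_orthogonal_diagonalization {n : Type*} [Fintype n]
    [DecidableEq n] {A : Matrix n n ℝ} (hA : A.IsHermitian) :
    ∃ Q : Matrix n n ℝ, Q.transpose * Q = 1 ∧ Q * Q.transpose = 1 ∧
      A = Q * Matrix.diagonal hA.eigenvalues * Q.transpose := by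
  refine ⟨hA.eigenvectorUnitary, ?_, ?_, ?_⟩
  · have := Unitary.coe_star_mul_self hA.eigenvectorUnitary
    rwa [Matrix.star_eq_conjTranspose, Matrix.conjTranspose_eq_transpose_of_trivial] at this
  · have := Unitary.coe_mul_star_self hA.eigenvectorUnitary
    rwa [Unitary.coe_star, Matrix.star_eq_conjTranspose, Matrix.conjTranspose_eq_transpose_of_trivial] at this
  · have := hA.spectral_theorem
    rw [Unitary.conjStarAlgAut_apply, Matrix.star_eq_conjTranspose,
      Matrix.conjTranspose_eq_transpose_of_trivial] at this
    exact this

/-- Selected columns of an orthogonal matrix of eigenvectors form an orthonormal frame of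
eigenvectors. -/
theorem Matrix.orthonormal_eigenframe {m n : Type*} [Fintype m] [DecidableEq m] [Fintype n]
    [DecidableEq n] {Q : Matrix n n ℝ} (hQ : Q.transpose * Q = 1) (d : n → ℝ) {f : m → n}
    (hf : Function.Injective f) :
    (Q.submatrix id f).transpose * Q.submatrix id f = 1 ∧
      (Q * Matrix.diagonal d * Q.transpose) * Q.submatrix id f =
        Q.submatrix id f * Matrix.diagonal (d ∘ f) := by
  constructor
  · rw [Matrix.transpose_submatrix, ← Matrix.submatrix_mul _ _ f id f Function.bijective_id, hQ,
      Matrix.submatrix_one _ hf]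
  · have h : (Q * Matrix.diagonal d * Q.transpose) * Q = Q * Matrix.diagonal d := by
      rw [Matrix.mul_assoc, hQ, Matrix.mul_one]
    ext i j
    have := congrFun (congrFun h i) (f j)
    rw [Matrix.mul_diagonal] at this ⊢
    exact this

/-! ### Absolute continuity and uniform Lipschitz bounds -/

open MeasureTheory in
/-- **Grönwall's inequality** for absolutely continuous functions. -/
theorem AbsolutelyContinuousOnInterval.le_exp_mul {φ : ℝ → ℝ} {T C : ℝ} (hT : 0 ≤ T)
    (hφ : AbsolutelyContinuousOnInterval φ 0 T)
    (hd : ∀ᵐ t ∂(volume.restrict (Set.Icc 0 T)), ∃ v, HasDerivAt φ v t ∧ v ≤ C * φ t) :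
    φ T ≤ Real.exp (C * T) * φ 0 := by
  have hexp : AbsolutelyContinuousOnInterval (fun t => Real.exp (-(C * t))) 0 T :=
    ContDiffOn.absolutelyContinuousOnInterval (by fun_prop)
  have hψ := hexp.fun_mul hφ
  have hint := hψ.integral_deriv_eq_sub
  have hle : 0 ≤ ∫ t in (0 : ℝ)..T, -deriv (fun x => Real.exp (-(C * x)) * φ x) t := by
    refine intervalIntegral.integral_nonneg_of_ae_restrict hT ?_
    filter_upwards [hd] with t ⟨v, hv, hle⟩
    have he : HasDerivAt (fun x => Real.exp (-(C * x))) (Real.exp (-(C * t)) * (-C)) t := by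
      refine HasDerivAt.exp ?_
      simpa using! ((hasDerivAt_id t).const_mul C).neg
    rw [(he.fun_mul hv).deriv]
    have := Real.exp_pos (-(C * t))
    simp only [Pi.zero_apply]
    nlinarith
  rw [intervalIntegral.integral_neg, hint] at hle
  simp only [mul_zero, neg_zero, Real.exp_zero, one_mul] at hle
  have h1 : Real.exp (C * T) * (Real.exp (-(C * T)) * φ T) = φ T := by
    rw [← mul_assoc, ← Real.exp_add]
    simp
  rw [← h1]
  exact mul_le_mul_of_nonneg_left (by linarith) (Real.exp_pos _).le

/-- The sums of increments that define absolute continuity are squeezed by those of the `f i`. Only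
increments of `g` enter, so `g` may be a maximum with no explicit formula. -/
theorem AbsolutelyContinuousOnInterval.of_abs_sub_le {ι : Type*} [Fintype ι] {f : ι → ℝ → ℝ}
    {g : ℝ → ℝ} {a b K : ℝ} (hf : ∀ i, AbsolutelyContinuousOnInterval (f i) a b)
    (hg : ∀ s ∈ Set.uIcc a b, ∀ t ∈ Set.uIcc a b, |g s - g t| ≤ K * ∑ i, |f i s - f i t|) :
    AbsolutelyContinuousOnInterval g a b := by
  have hlim := (tendsto_finsetSum Finset.univ fun i _ => hf i).const_mul K
  simp only [Finset.sum_const_zero, mul_zero] at hlim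
  refine squeeze_zero' (Filter.Eventually.of_forall fun E =>
    Finset.sum_nonneg fun i _ => dist_nonneg) ?_ hlim
  rw [Filter.eventually_inf_principal]
  refine Filter.Eventually.of_forall fun E hE => ?_
  rw [Finset.sum_comm, Finset.mul_sum]
  refine Finset.sum_le_sum fun i hi => ?_
  simp only [Real.dist_eq]
  exact hg _ (hE.1 i hi).1 _ (hE.1 i hi).2

/-- A polynomial is Lipschitz on a compact convex box. The constant is uniform in `V`, which later
allows the frame to vary arbitrarily with time. -/
theorem Matrix.exists_abs_det_compression_sub_le (m n : Type*) [Fintype m] [DecidableEq m]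
    [Fintype n] (r : ℝ) :
    ∃ K : ℝ, ∀ (V : Matrix n m ℝ) (S S' : Matrix n n ℝ), (∀ i a, |V i a| ≤ 1) →
      (∀ i j, |S i j| ≤ r) → (∀ i j, |S' i j| ≤ r) →
      |(V.transpose * S * V).det - (V.transpose * S' * V).det| ≤
        K * ∑ p : n × n, |S p.1 p.2 - S' p.1 p.2| := by
  by_cases hr : 0 ≤ r
  swap
  · refine ⟨0, fun V S S' _ hS _ => ?_⟩
    by_cases hn : Nonempty n
    · exact absurd ((abs_nonneg _).trans (hS hn.some hn.some)) hr
    · rw [not_nonempty_iff] at hn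
      simp [Subsingleton.elim S S']
  let F : (n → n → ℝ) × (n → m → ℝ) → ℝ := fun x =>
    ((Matrix.of x.2).transpose * Matrix.of x.1 * Matrix.of x.2).det
  have hF : ContDiff ℝ 1 F := by
    simp only [F, Matrix.det_apply', Matrix.mul_apply, Matrix.transpose_apply, Matrix.of_apply]
    fun_prop
  obtain ⟨K, hK⟩ := hF.contDiffOn.exists_lipschitzOnWith (by decide)
    ((convex_closedBall (0 : n → n → ℝ) r).prod (convex_closedBall (0 : n → m → ℝ) 1))
    ((isCompact_closedBall (0 : n → n → ℝ) r).prod (isCompact_closedBall (0 : n → m → ℝ) 1))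
  have hmem : ∀ (V : Matrix n m ℝ) (S : Matrix n n ℝ), (∀ i a, |V i a| ≤ 1) →
      (∀ i j, |S i j| ≤ r) → ((S, V) : (n → n → ℝ) × (n → m → ℝ)) ∈
        Metric.closedBall (0 : n → n → ℝ) r ×ˢ Metric.closedBall (0 : n → m → ℝ) 1 := by
    intro V S hV hS
    rw [Set.mem_prod, mem_closedBall_zero_iff, mem_closedBall_zero_iff]
    exact ⟨(pi_norm_le_iff_of_nonneg hr).2 fun i => (pi_norm_le_iff_of_nonneg hr).2 fun j => hS i j,
      (pi_norm_le_iff_of_nonneg zero_le_one).2 fun i =>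
        (pi_norm_le_iff_of_nonneg zero_le_one).2 fun j => hV i j⟩
  refine ⟨K, fun V S S' hV hS hS' => ?_⟩
  have h := hK.dist_le_mul _ (hmem V S hV hS) _ (hmem V S' hV hS')
  rw [Real.dist_eq] at h
  refine h.trans (mul_le_mul_of_nonneg_left ?_ K.2)
  have hsum : 0 ≤ ∑ p : n × n, |S p.1 p.2 - S' p.1 p.2| :=
    Finset.sum_nonneg fun p _ => abs_nonneg _
  rw [Prod.dist_eq, dist_self, max_eq_left dist_nonneg]
  refine (dist_pi_le_iff hsum).2 fun i => (dist_pi_le_iff hsum).2 fun j => ?_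
  rw [Real.dist_eq]
  exact Finset.single_le_sum (f := fun p : n × n => |S p.1 p.2 - S' p.1 p.2|)
    (fun p _ => abs_nonneg _) (Finset.mem_univ (i, j))

/-! ### Symmetry, determinant and positivity of Lyapunov solutions -/

theorem IsLyapunovSolution.mono {n : ℕ} {A S : ℝ → Matrix (Fin n) (Fin n) ℝ} {T t : ℝ}
    (h : IsLyapunovSolution A S T) (ht : t ∈ Set.Icc 0 T) : IsLyapunovSolution A S t := by
  refine ⟨fun i j => (h.1 i j).mono ?_, ?_⟩
  · rw [Set.uIcc_of_le ht.1, Set.uIcc_of_le (ht.1.trans ht.2)]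
    exact Set.Icc_subset_Icc_right ht.2
  · exact MeasureTheory.ae_restrict_of_ae_restrict_of_subset (Set.Icc_subset_Icc_right ht.2) h.2

theorem IsLyapunovSolution.exists_bound {n : ℕ} {A S : ℝ → Matrix (Fin n) (Fin n) ℝ} {T : ℝ}
    (h : IsLyapunovSolution A S T) : ∃ r, ∀ t ∈ Set.uIcc 0 T, ∀ i j, |S t i j| ≤ r := by
  choose r hr using fun i j => (h.1 i j).exists_bound
  refine ⟨∑ i, ∑ j, |r i j|, fun t ht i j => ?_⟩
  refine ((hr i j t ht).trans (le_abs_self _)).trans ?_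
  refine le_trans ?_ (Finset.single_le_sum (f := fun i => ∑ j, |r i j|)
    (fun i _ => Finset.sum_nonneg fun j _ => abs_nonneg _) (Finset.mem_univ i))
  exact Finset.single_le_sum (f := fun j => |r i j|) (fun j _ => abs_nonneg _) (Finset.mem_univ j)

theorem Matrix.abs_apply_le_one_of_transpose_mul_self {m n : Type*} [Fintype m] [DecidableEq m]
    [Fintype n] {W : Matrix n m ℝ} (hW : W.transpose * W = 1) (j : n) (a : m) : |W j a| ≤ 1 := by
  have h := Matrix.sum_sq_row_le_one hW j
  have h1 := Finset.single_le_sum (f := fun a => W j a ^ 2) (fun a _ => sq_nonneg _)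
    (Finset.mem_univ a)
  rw [← sq_le_one_iff_abs_le_one]
  exact h1.trans h

theorem Matrix.abs_conj_apply_le {n : Type*} [Fintype n] [DecidableEq n] {U : Matrix n n ℝ}
    (hU : U.transpose * U = 1) (D : Matrix n n ℝ) (i j : n) :
    |(U * D * U.transpose) i j| ≤ ∑ p, ∑ q, |D p q| := by
  simp only [Matrix.mul_apply, Matrix.transpose_apply, Finset.sum_mul]
  rw [Finset.sum_comm]
  refine (Finset.abs_sum_le_sum_abs _ _).trans (Finset.sum_le_sum fun p _ => ?_)
  refine (Finset.abs_sum_le_sum_abs _ _).trans (Finset.sum_le_sum fun q _ => ?_)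
  rw [abs_mul, abs_mul]
  have h1 := Matrix.abs_apply_le_one_of_transpose_mul_self hU i p
  have h2 := Matrix.abs_apply_le_one_of_transpose_mul_self hU j q
  calc |U i p| * |D p q| * |U j q| ≤ 1 * |D p q| * 1 := by gcongr
    _ = |D p q| := by ring

/-- Bounds half the growth rate of the squared Frobenius norm along `R' = A R + R A`, by applying
`2xz ≤ x² + z²` to each term; it feeds Grönwall in the proof of symmetry. -/
theorem Matrix.sum_mul_mul_apply_le {n : Type*} [Fintype n] {A R : Matrix n n ℝ} {a : ℝ}
    (hA : ∀ i j, |A i j| ≤ a) :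
    ∑ i, ∑ j, R i j * (A * R + R * A) i j ≤ 2 * a * Fintype.card n * ∑ i, ∑ j, R i j ^ 2 := by
  have young : ∀ x y z : ℝ, |y| ≤ a → x * (y * z) ≤ a / 2 * (x ^ 2 + z ^ 2) := by
    intro x y z hy
    obtain ⟨h1, h2⟩ := abs_le.1 hy
    nlinarith [mul_nonneg (sub_nonneg.2 h2) (sq_nonneg (x - z)),
      mul_nonneg (neg_le_iff_add_nonneg.1 h1) (sq_nonneg (x + z))]
  have h1 : ∀ i j, R i j * (A * R + R * A) i j ≤
      ∑ l, (a / 2 * (R i j ^ 2 + R l j ^ 2) + a / 2 * (R i j ^ 2 + R i l ^ 2)) := by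
    intro i j
    rw [Matrix.add_apply, Matrix.mul_apply, Matrix.mul_apply, ← Finset.sum_add_distrib,
      Finset.mul_sum]
    refine Finset.sum_le_sum fun l _ => ?_
    rw [mul_add, mul_comm (R i l)]
    exact add_le_add (young _ _ _ (hA i l)) (young _ _ _ (hA l j))
  refine (Finset.sum_le_sum fun i _ => Finset.sum_le_sum fun j _ => h1 i j).trans_eq ?_
  simp only [Finset.sum_add_distrib, ← Finset.mul_sum, Finset.sum_const, Finset.card_univ,
    nsmul_eq_mul, mul_add]
  rw [Finset.sum_comm (f := fun i j => R j i ^ 2)]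
  ring

/-- Solutions with symmetric bounded coefficient and symmetric initial value stay symmetric. -/
theorem IsLyapunovSolution.transpose_eq {n : ℕ} {A S : ℝ → Matrix (Fin n) (Fin n) ℝ} {T a : ℝ}
    (hT : 0 ≤ T) (h : IsLyapunovSolution A S T)
    (hA : ∀ t ∈ Set.Icc 0 T, ∀ i j, |A t i j| ≤ a)
    (hsymm : ∀ t ∈ Set.Icc 0 T, (A t).transpose = A t) (h0 : (S 0).transpose = S 0) :
    (S T).transpose = S T := by
  let φ : ℝ → ℝ := fun t => ∑ i, ∑ j, (S t i j - S t j i) ^ 2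
  have hac : AbsolutelyContinuousOnInterval φ 0 T := by
    have hsum : ∀ f : Fin n → ℝ → ℝ, (∀ i, AbsolutelyContinuousOnInterval (f i) 0 T) →
        AbsolutelyContinuousOnInterval (fun t => ∑ i, f i t) 0 T := fun f hf =>
      AbsolutelyContinuousOnInterval.of_abs_sub_le (K := 1) hf fun s _ t _ => by
        rw [one_mul, ← Finset.sum_sub_distrib]
        exact Finset.abs_sum_le_sum_abs _ _
    refine hsum _ fun i => hsum _ fun j => ?_
    simp only [sq]
    exact ((h.1 i j).fun_sub (h.1 j i)).fun_mul ((h.1 i j).fun_sub (h.1 j i))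
  -- As `A` is symmetric, `S - Sᵀ` solves the same equation. Its squared norm `φ` thus grows at rate
  -- at most `4 * a * n`, twice the constant of `Matrix.sum_mul_mul_apply_le`, and starts at zero.
  have hle := hac.le_exp_mul (C := 4 * a * n) hT (by
    filter_upwards [h.2, MeasureTheory.ae_restrict_mem measurableSet_Icc] with t ht htm
    refine ⟨_, HasDerivAt.fun_sum fun i _ => HasDerivAt.fun_sum fun j _ =>
      ((ht i j).fun_sub (ht j i)).fun_pow 2, ?_⟩
    have key := Matrix.sum_mul_mul_apply_le (A := A t) (R := S t - (S t).transpose) (hA t htm)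
    have hR : ∀ i j, (A t * (S t - (S t).transpose) + (S t - (S t).transpose) * A t) i j =
        (A t * S t + S t * A t) i j - (A t * S t + S t * A t) j i := by
      intro i j
      rw [← Matrix.transpose_apply (A t * S t + S t * A t) i j, ← Matrix.sub_apply]
      refine congrFun (congrFun ?_ i) j
      rw [Matrix.transpose_add, Matrix.transpose_mul, Matrix.transpose_mul, hsymm t htm, mul_sub,
        sub_mul]
      abel
    simp only [hR, Matrix.sub_apply, Matrix.transpose_apply, Fintype.card_fin] at key
    simp only [φ]
    have := mul_le_mul_of_nonneg_left key (zero_le_two (α := ℝ))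
    refine (le_of_eq ?_).trans (this.trans_eq (by ring))
    simp only [Finset.mul_sum]
    refine Finset.sum_congr rfl fun i _ => Finset.sum_congr rfl fun j _ => ?_
    simp only [Nat.cast_ofNat, Nat.add_one_sub_one, pow_one]
    ring)
  have hz : φ 0 = 0 := by
    simp only [φ]
    refine Finset.sum_eq_zero fun i _ => Finset.sum_eq_zero fun j _ => ?_
    rw [← Matrix.transpose_apply (S 0), h0, sub_self, sq, zero_mul]
  rw [hz, mul_zero] at hle
  have hnn : ∀ i ∈ Finset.univ, 0 ≤ ∑ j, (S T i j - S T j i) ^ 2 := fun i _ =>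
    Finset.sum_nonneg fun j _ => sq_nonneg _
  have hzero := (Finset.sum_eq_zero_iff_of_nonneg hnn).1
    (le_antisymm hle (Finset.sum_nonneg hnn))
  ext i j
  have := (Finset.sum_eq_zero_iff_of_nonneg fun j _ => sq_nonneg _).1
    (hzero j (Finset.mem_univ j)) i (Finset.mem_univ i)
  rw [Matrix.transpose_apply]
  exact sub_eq_zero.1 (pow_eq_zero_iff (two_ne_zero) |>.1 this)

open Matrix in
/-- A continuous path of invertible symmetric matrices that starts at a positive definite matrix
stays positive definite. -/
theorem Matrix.posDef_of_continuousOn {n : Type*} [Fintype n] [DecidableEq n]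
    {S : ℝ → Matrix n n ℝ} {T : ℝ} (hS : ∀ i j, ContinuousOn (fun t => S t i j) (Set.Icc 0 T))
    (hsymm : ∀ t ∈ Set.Icc 0 T, (S t).IsHermitian) (hdet : ∀ t ∈ Set.Icc 0 T, (S t).det ≠ 0)
    (h0 : (S 0).PosDef) : ∀ t ∈ Set.Icc 0 T, (S t).PosDef := by
  have hq : ContinuousOn (fun p : ℝ × (n → ℝ) => p.2 ⬝ᵥ (S p.1 *ᵥ p.2))
      (Set.Icc 0 T ×ˢ Metric.sphere (0 : n → ℝ) 1) := by
    simp only [dotProduct, mulVec]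
    refine continuousOn_finsetSum _ fun i _ => ContinuousOn.mul (by fun_prop)
      (continuousOn_finsetSum _ fun j _ => ContinuousOn.mul ?_ (by fun_prop))
    exact (hS i j).comp continuousOn_fst fun p hp => hp.1
  have hcomp : IsCompact (Set.Icc 0 T ×ˢ Metric.sphere (0 : n → ℝ) 1) :=
    isCompact_Icc.prod (isCompact_sphere _ _)
  have hKc := (hcomp.of_isClosed_subset
    (hq.preimage_isClosed_of_isClosed hcomp.isClosed (isClosed_Iic (a := (0 : ℝ))))
    Set.inter_subset_left).image continuous_fst
  -- `K` is the set of times at which positivity fails, compact as a projection of a compact set. At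
  -- its least element `u` the form is a limit of positive ones, hence semidefinite, and
  -- invertibility makes it definite: a contradiction.
  set K := Prod.fst '' ((Set.Icc 0 T ×ˢ Metric.sphere (0 : n → ℝ) 1) ∩
    (fun p : ℝ × (n → ℝ) => p.2 ⬝ᵥ (S p.1 *ᵥ p.2)) ⁻¹' Set.Iic 0) with hK
  have hnotK : ∀ t ∈ Set.Icc 0 T, t ∉ K → (S t).PosDef := by
    intro t ht htK
    refine PosDef.of_dotProduct_mulVec_pos (hsymm t ht) fun x hx => ?_
    rw [star_trivial]
    have hx' : 0 < ‖x‖ := norm_pos_iff.2 hx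
    by_contra hcon
    refine htK ⟨(t, ‖x‖⁻¹ • x), ⟨⟨ht, ?_⟩, ?_⟩, rfl⟩
    · simp [norm_smul, hx'.ne']
    · simp only [Set.mem_preimage, Set.mem_Iic, mulVec_smul, smul_dotProduct, dotProduct_smul,
        smul_eq_mul]
      rw [not_lt] at hcon
      exact mul_nonpos_of_nonneg_of_nonpos (inv_nonneg.2 hx'.le)
        (mul_nonpos_of_nonneg_of_nonpos (inv_nonneg.2 hx'.le) hcon)
  have hKnot : ∀ t ∈ K, ¬ (S t).PosDef := by
    rintro _ ⟨⟨t, v⟩, ⟨⟨ht, hv⟩, hle⟩, rfl⟩ hpd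
    have hv0 : v ≠ 0 := by
      rintro rfl
      simp at hv
    have := hpd.dotProduct_mulVec_pos hv0
    rw [star_trivial] at this
    exact absurd hle (not_le.2 this)
  intro t ht
  refine hnotK t ht fun htK => ?_
  obtain ⟨u, huK, hu⟩ := hKc.exists_isLeast ⟨t, htK⟩
  have huT : u ∈ Set.Icc 0 T := by
    obtain ⟨p, hp, rfl⟩ := huK
    exact hp.1.1
  have hu0 : 0 < u := lt_of_le_of_ne huT.1 fun h => hKnot u huK (h ▸ h0)
  refine hKnot u huK ?_
  refine (PosSemidef.posDef_iff_det_ne_zero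
    (PosSemidef.of_dotProduct_mulVec_nonneg (hsymm u huT) fun x => ?_)).2 (hdet u huT)
  have hcont : ContinuousOn (fun s => star x ⬝ᵥ (S s *ᵥ x)) (Set.Icc 0 T) := by
    simp only [dotProduct, mulVec]
    exact continuousOn_finsetSum _ fun i _ => continuousOn_const.mul
      (continuousOn_finsetSum _ fun j _ => (hS i j).mul continuousOn_const)
  have hsub : Set.Ico 0 u ⊆ Set.Icc 0 T := fun s hs => ⟨hs.1, hs.2.le.trans huT.2⟩
  have hne : (nhdsWithin u (Set.Ico 0 u)).NeBot := by
    rw [← mem_closure_iff_nhdsWithin_neBot, closure_Ico hu0.ne]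
    exact ⟨hu0.le, le_rfl⟩
  refine ge_of_tendsto ((hcont u huT).mono hsub) ?_
  filter_upwards [self_mem_nhdsWithin] with s hs
  refine (hnotK s (hsub hs) fun hsK => ?_).posSemidef.dotProduct_mulVec_nonneg x
  exact absurd (hu hsK) (not_le.2 hs.2)

/-- The coefficient has the orthogonally diagonalized form with spectrum `d` on `[0, T]`. -/
def HasSpectrumOn {n : ℕ} (A : ℝ → Matrix (Fin n) (Fin n) ℝ) (d : Fin n → ℝ) (T : ℝ) : Prop :=
  ∀ t ∈ Set.Icc 0 T, ∃ Q : Matrix (Fin n) (Fin n) ℝ, Q.transpose * Q = 1 ∧ Q * Q.transpose = 1 ∧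
    A t = Q * Matrix.diagonal d * Q.transpose

theorem HasSpectrumOn.mono {n : ℕ} {A : ℝ → Matrix (Fin n) (Fin n) ℝ} {d : Fin n → ℝ} {T t : ℝ}
    (h : HasSpectrumOn A d T) (ht : t ≤ T) : HasSpectrumOn A d t :=
  fun s hs => h s ⟨hs.1, hs.2.trans ht⟩

theorem HasSpectrumOn.trace_eq {n : ℕ} {A : ℝ → Matrix (Fin n) (Fin n) ℝ} {d : Fin n → ℝ} {T : ℝ}
    (h : HasSpectrumOn A d T) {t : ℝ} (ht : t ∈ Set.Icc 0 T) : (A t).trace = ∑ i, d i := by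
  obtain ⟨Q, hQ, -, hA⟩ := h t ht
  rw [hA, Matrix.trace_mul_comm, ← Matrix.mul_assoc, hQ, Matrix.one_mul, Matrix.trace_diagonal]

theorem IsLyapunovSolution.isHermitian {n : ℕ} {A S : ℝ → Matrix (Fin n) (Fin n) ℝ}
    {d : Fin n → ℝ} {T : ℝ} (h : IsLyapunovSolution A S T) (hA : HasSpectrumOn A d T)
    (h0 : (S 0).IsHermitian) {t : ℝ} (ht : t ∈ Set.Icc 0 T) : (S t).IsHermitian := by
  rw [Matrix.IsHermitian, Matrix.conjTranspose_eq_transpose_of_trivial] at h0 ⊢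
  refine (h.mono ht).transpose_eq (a := ∑ p, ∑ q, |Matrix.diagonal d p q|) ht.1 ?_ ?_ h0
  · intro s hs i j
    obtain ⟨Q, hQ, -, hA⟩ := (hA.mono ht.2) s hs
    rw [hA]
    exact Matrix.abs_conj_apply_le hQ _ i j
  · intro s hs
    obtain ⟨Q, hQ, -, hA⟩ := (hA.mono ht.2) s hs
    rw [hA]
    simp [Matrix.transpose_mul, Matrix.mul_assoc]

/-- **Liouville's formula** for the Lyapunov equation. -/
theorem IsLyapunovSolution.det_eq {n : ℕ} {A S : ℝ → Matrix (Fin n) (Fin n) ℝ} {d : Fin n → ℝ}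
    {T : ℝ} (hT : 0 ≤ T) (h : IsLyapunovSolution A S T) (hA : HasSpectrumOn A d T)
    (h0 : (S 0).IsHermitian) : (S T).det = Real.exp (2 * (∑ i, d i) * T) * (S 0).det := by
  obtain ⟨r, hr⟩ := h.exists_bound
  obtain ⟨K, hK⟩ := Matrix.exists_abs_det_compression_sub_le (Fin n) (Fin n) r
  have hac : AbsolutelyContinuousOnInterval (fun t => (S t).det) 0 T :=
    AbsolutelyContinuousOnInterval.of_abs_sub_le (fun p : Fin n × Fin n => h.1 p.1 p.2)
      fun s hs t ht => by
        simpa using hK 1 (S s) (S t)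
          (Matrix.abs_apply_le_one_of_transpose_mul_self (by simp)) (hr s hs) (hr t ht)
  have hder : ∀ᵐ t ∂(MeasureTheory.volume.restrict (Set.Icc 0 T)),
      HasDerivAt (fun t => (S t).det) (2 * (∑ i, d i) * (S t).det) t := by
    filter_upwards [h.2, MeasureTheory.ae_restrict_mem measurableSet_Icc] with t ht htm
    have hsymm := h.isHermitian hA h0 htm
    obtain ⟨Q, hQ, hQ', hS⟩ := hsymm.exists_orthogonal_diagonalization
    rw [Matrix.IsHermitian, Matrix.conjTranspose_eq_transpose_of_trivial] at hsymm
    have hSQ : S t * Q = Q * Matrix.diagonal (Matrix.IsHermitian.eigenvalues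
        (h.isHermitian hA h0 htm)) := by
      conv_lhs => rw [hS]
      rw [Matrix.mul_assoc, hQ, Matrix.mul_one]
    -- For a full orthogonal frame the compression has the determinant of the matrix itself. Only
    -- symmetry is used, since positivity is deduced from this formula.
    have hd := Matrix.hasDerivAt_det_compression ht hsymm hQ hSQ
    have hdet : ∀ M : Matrix (Fin n) (Fin n) ℝ, (Q.transpose * M * Q).det = M.det := by
      intro M
      rw [Matrix.det_mul_comm, ← Matrix.mul_assoc, hQ', Matrix.one_mul]
    have htr : (Q.transpose * A t * Q).trace = ∑ i, d i := by
      rw [Matrix.trace_mul_comm, ← Matrix.mul_assoc, hQ', Matrix.one_mul, hA.trace_eq htm]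
    simpa only [hdet, htr] using hd
  refine le_antisymm (hac.le_exp_mul hT ?_) ?_
  · filter_upwards [hder] with t ht using ⟨_, ht, le_rfl⟩
  -- Grönwall for `-det` supplies the reverse inequality.
  · have := hac.fun_neg.le_exp_mul (C := 2 * ∑ i, d i) hT (by
      filter_upwards [hder] with t ht using ⟨_, ht.fun_neg, by simp⟩)
    linarith

theorem IsLyapunovSolution.posDef {n : ℕ} {A S : ℝ → Matrix (Fin n) (Fin n) ℝ} {d : Fin n → ℝ}
    {T : ℝ} (h : IsLyapunovSolution A S T) (hA : HasSpectrumOn A d T)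
    (h0 : (S 0).PosDef) {t : ℝ} (ht : t ∈ Set.Icc 0 T) : (S t).PosDef := by
  refine Matrix.posDef_of_continuousOn (fun i j => ?_)
    (fun s hs => h.isHermitian hA h0.isHermitian hs) (fun s hs => ?_) h0 t ht
  · rw [← Set.uIcc_of_le (ht.1.trans ht.2)]
    exact (h.1 i j).continuousOn
  · rw [(h.mono hs).det_eq hs.1 (hA.mono hs.2) h0.isHermitian]
    exact mul_ne_zero (Real.exp_ne_zero _) h0.det_pos.ne'

/-! ### Necessity: growth of the maximal compression determinants -/

/-- A positive definite matrix has an orthonormal eigenframe that maximizes the determinant of the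
compression. -/
theorem Matrix.PosDef.exists_maximal_eigenframe {m n : Type*} [Fintype m] [DecidableEq m]
    [Fintype n] [DecidableEq n] (hmn : Fintype.card m ≤ Fintype.card n) {S : Matrix n n ℝ}
    (hS : S.PosDef) :
    ∃ (V : Matrix n m ℝ) (d : m → ℝ), V.transpose * V = 1 ∧
      S * V = V * Matrix.diagonal d ∧ 0 ≤ (V.transpose * S * V).det ∧
      ∀ W : Matrix n m ℝ, W.transpose * W = 1 →
        (W.transpose * S * W).det ≤ (V.transpose * S * V).det := by
  classical
  obtain ⟨Q, hQ, hQ', hSQ⟩ := hS.isHermitian.exists_orthogonal_diagonalization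
  set ev := hS.isHermitian.eigenvalues with hev
  obtain ⟨g⟩ := Function.Embedding.nonempty_of_card_le hmn
  obtain ⟨f, hf, hmax⟩ := Finset.exists_max_image
    (Finset.univ.filter fun f : m → n => Function.Injective f) (fun f => ∏ a, ev (f a))
    ⟨g, by simpa using g.injective⟩
  simp only [Finset.mem_filter, Finset.mem_univ, true_and] at hf hmax
  obtain ⟨hV, hVd⟩ := Matrix.orthonormal_eigenframe hQ ev hf
  rw [← hSQ] at hVd
  have hdet : ((Q.submatrix id f).transpose * S * Q.submatrix id f).det = ∏ a, ev (f a) := by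
    rw [Matrix.mul_assoc, hVd, ← Matrix.mul_assoc, hV, Matrix.one_mul, Matrix.det_diagonal]
    rfl
  refine ⟨_, _, hV, hVd, ?_, fun W hW => ?_⟩
  · rw [hdet]
    exact Finset.prod_nonneg fun a _ => (hS.eigenvalues_pos _).le
  · rw [hdet]
    conv_lhs => rw [hSQ]
    exact Matrix.det_transpose_mul_mul_le hQ' ev hmax hW

/-- Along the controlled Lyapunov equation the compression determinants grow at most at twice the
rate given by the `k` largest eigenvalues of the coefficient. -/
theorem IsLyapunovSolution.det_compression_le {n k : ℕ} (hk : k ≤ n)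
    {A S : ℝ → Matrix (Fin n) (Fin n) ℝ} {d : Fin n → ℝ} {T c : ℝ} (hT : 0 ≤ T)
    (h : IsLyapunovSolution A S T) (hA : HasSpectrumOn A d T) (hc : 0 < c) (h0 : S 0 = c • 1)
    {W : Matrix (Fin n) (Fin k) ℝ} (hW : W.transpose * W = 1) :
    (W.transpose * S T * W).det ≤
      Real.exp (2 * (∑ i : Fin n with i.val < k, decreasingRearrangement d i) * T) * c ^ k := by
  have hpos0 : (S 0).PosDef := by
    rw [h0]
    exact Matrix.PosDef.one.smul hc
  have hframe : ∀ t, ∃ (V : Matrix (Fin n) (Fin k) ℝ) (e : Fin k → ℝ), t ∈ Set.Icc 0 T →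
      V.transpose * V = 1 ∧ S t * V = V * Matrix.diagonal e ∧
        0 ≤ (V.transpose * S t * V).det ∧ ∀ W : Matrix (Fin n) (Fin k) ℝ, W.transpose * W = 1 →
          (W.transpose * S t * W).det ≤ (V.transpose * S t * V).det := by
    intro t
    by_cases ht : t ∈ Set.Icc 0 T
    · obtain ⟨V, e, hV⟩ := (h.posDef hA hpos0 ht).exists_maximal_eigenframe (m := Fin k)
        (by simpa using hk)
      exact ⟨V, e, fun _ => hV⟩
    · exact ⟨0, 0, fun h => absurd h ht⟩
  choose V e hV using hframe
  set G : ℝ → ℝ := fun t => ((V t).transpose * S t * V t).det with hG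
  have huIcc : Set.uIcc 0 T = Set.Icc 0 T := Set.uIcc_of_le hT
  obtain ⟨r, hr⟩ := h.exists_bound
  obtain ⟨K, hK⟩ := Matrix.exists_abs_det_compression_sub_le (Fin k) (Fin n) r
  have hac : AbsolutelyContinuousOnInterval G 0 T := by
    refine AbsolutelyContinuousOnInterval.of_abs_sub_le (K := K)
      (fun p : Fin n × Fin n => h.1 p.1 p.2) fun s hs t ht => ?_
    have hVs := hV s (huIcc ▸ hs)
    have hVt := hV t (huIcc ▸ ht)
    have h1 := hK (V s) (S s) (S t)
      (Matrix.abs_apply_le_one_of_transpose_mul_self hVs.1) (hr s hs) (hr t ht)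
    have h2 := hK (V t) (S s) (S t)
      (Matrix.abs_apply_le_one_of_transpose_mul_self hVt.1) (hr s hs) (hr t ht)
    -- Testing each maximum with the other time's frame bounds `G s - G t` on both sides by
    -- increments along a fixed frame.
    have h3 := hVt.2.2.2 _ hVs.1
    have h4 := hVs.2.2.2 _ hVt.1
    rw [abs_le] at h1 h2 ⊢
    constructor <;> simp only [hG] <;> linarith [h1.1, h1.2, h2.1, h2.2]
  have hGT := hac.le_exp_mul
    (C := 2 * ∑ i : Fin n with i.val < k, decreasingRearrangement d i) hT (by
      have hdiff := MeasureTheory.ae_restrict_of_ae (s := Set.Icc 0 T) hac.ae_differentiableAt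
      have hne : ∀ x : ℝ, ∀ᵐ t ∂(MeasureTheory.volume.restrict (Set.Icc 0 T)), t ≠ x := fun x =>
        MeasureTheory.ae_restrict_of_ae (MeasureTheory.Measure.ae_ne _ x)
      filter_upwards [h.2, MeasureTheory.ae_restrict_mem measurableSet_Icc, hdiff, hne 0, hne T]
        with t ht htm hd ht0 htT
      obtain ⟨hVV, hVe, hnn, -⟩ := hV t htm
      have hsymm := h.isHermitian hA hpos0.isHermitian htm
      rw [Matrix.IsHermitian, Matrix.conjTranspose_eq_transpose_of_trivial] at hsymm
      have hF := Matrix.hasDerivAt_det_compression ht hsymm hVV hVe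
      have hGd := (hd (huIcc ▸ htm)).hasDerivAt
      -- Envelope argument: the determinant along the frozen frame `V t` lies below `G` and touches
      -- it at `t`, so the derivatives agree. A two-sided neighbourhood is needed, hence the removal
      -- of the endpoints.
      have hmin : IsLocalMin (fun s => G s - ((V t).transpose * S s * V t).det) t := by
        have hnhds : Set.Icc 0 T ∈ nhds t :=
          Icc_mem_nhds (lt_of_le_of_ne htm.1 (Ne.symm ht0)) (lt_of_le_of_ne htm.2 htT)
        filter_upwards [hnhds] with s hs
        have := (hV s hs).2.2.2 _ hVV
        simp only [hG, sub_self]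
        linarith
      have hzero := hmin.hasDerivAt_eq_zero (hGd.fun_sub hF)
      refine ⟨_, hGd, ?_⟩
      rw [sub_eq_zero.1 hzero]
      refine mul_le_mul_of_nonneg_right (mul_le_mul_of_nonneg_left ?_ zero_le_two) hnn
      obtain ⟨Q, -, hQ', hAQ⟩ := hA t htm
      rw [hAQ]
      exact Matrix.trace_compression_le hk hQ' d hVV)
  refine ((hV T ⟨hT, le_rfl⟩).2.2.2 W hW).trans (hGT.trans_eq ?_)
  congr 1
  simp only [hG, h0, Matrix.mul_smul, Matrix.smul_mul, Matrix.mul_one,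
    (hV 0 ⟨le_rfl, hT⟩).1, Matrix.det_smul, Matrix.det_one, Fintype.card_fin, mul_one]

/-- The eigenvalues reached along the controlled Lyapunov equation satisfy the majorization
constraint. -/
theorem IsLyapunovSolution.isMajorizedBy {n : ℕ} {A S : ℝ → Matrix (Fin n) (Fin n) ℝ}
    {d : Fin n → ℝ} {T c : ℝ} (hT : 0 ≤ T) (h : IsLyapunovSolution A S T)
    (hA : HasSpectrumOn A d T) (hc : 0 < c) (h0 : S 0 = c • 1) (hST : (S T).PosDef) :
    IsMajorizedBy (fun i => Real.log (hST.isHermitian.eigenvalues i))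
      (fun i => Real.log c + 2 * T * d i) := by
  have hev : ∀ i, 0 < hST.isHermitian.eigenvalues i := hST.eigenvalues_pos
  constructor
  · have hdet := h.det_eq hT hA (by
      rw [h0]
      exact (Matrix.PosDef.one.smul hc).isHermitian)
    rw [h0, hST.isHermitian.det_eq_prod_eigenvalues, Matrix.det_smul, Matrix.det_one, mul_one,
      Fintype.card_fin] at hdet
    have := congrArg Real.log hdet
    simp only [RCLike.ofReal_real_eq_id, id] at this
    rw [Real.log_prod (fun i _ => (hev i).ne'),
      Real.log_mul (Real.exp_ne_zero _) (pow_ne_zero _ hc.ne'), Real.log_exp, Real.log_pow] at this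
    rw [this, Finset.sum_add_distrib, ← Finset.mul_sum]
    simp
    ring
  · intro k _ hkn
    obtain ⟨e, he⟩ := exists_perm_decreasingRearrangement
      fun i => Real.log (hST.isHermitian.eigenvalues i)
    obtain ⟨p, hp⟩ := exists_perm_decreasingRearrangement d
    obtain ⟨Q, hQ, -, hSQ⟩ := hST.isHermitian.exists_orthogonal_diagonalization
    have hinj : Function.Injective fun a : Fin k => e (Fin.castLE hkn.le a) :=
      e.injective.comp (Fin.castLE_injective hkn.le)
    obtain ⟨hV, hVd⟩ := Matrix.orthonormal_eigenframe hQ hST.isHermitian.eigenvalues hinj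
    rw [← hSQ] at hVd
    have hle := h.det_compression_le hkn.le hT hA hc h0 hV
    rw [Matrix.mul_assoc, hVd, ← Matrix.mul_assoc, hV, Matrix.one_mul, Matrix.det_diagonal] at hle
    simp only [Function.comp_apply] at hle
    have hlog := Real.log_le_log (Finset.prod_pos fun a _ => hev _) hle
    rw [Real.log_prod (fun i _ => (hev _).ne'),
      Real.log_mul (Real.exp_ne_zero _) (pow_ne_zero _ hc.ne'), Real.log_exp, Real.log_pow] at hlog
    have hsum : ∀ u : Fin n → ℝ, ∑ i : Fin n with i.val < k, u i =
        ∑ a : Fin k, u (Fin.castLE hkn.le a) := by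
      intro u
      rw [sum_filter_val_lt_eq_sum_range hkn.le, Finset.sum_range]
      refine Finset.sum_congr rfl fun a _ => ?_
      rw [dif_pos (a.2.trans hkn)]
      rfl
    -- It is enough to list the right-hand vector in the order `p` that sorts `d`: any listing
    -- bounds the sorted partial sum from below.
    have hmaj := sum_comp_le_sum_decreasingRearrangement hkn.le
      (fun i => Real.log c + 2 * T * d i) p
    refine le_trans ?_ hmaj
    simp only [← hp, he]
    rw [hsum fun i => Real.log (hST.isHermitian.eigenvalues (e i))]
    refine hlog.trans_eq ?_
    rw [hsum, hsum, Finset.sum_add_distrib, ← Finset.mul_sum]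
    simp
    ring

/-! ### Sufficiency: switching between permutations of the spectrum -/

/-- Prescribed occupation times are realized by a measurable switching function. -/
theorem exists_measurable_occupation {ι : Type*} (s : Finset ι) (w : ι → ℝ) (hw : ∀ i, 0 ≤ w i)
    [Nonempty ι] :
    ∃ σ : ℝ → ι, ∀ f : ι → ℝ, Measurable (fun t => f (σ t)) ∧ (∃ r, ∀ t, |f (σ t)| ≤ r) ∧
      ∫ t in (0 : ℝ)..∑ i ∈ s, w i, f (σ t) = ∑ i ∈ s, w i * f i := by
  classical
  induction s using Finset.induction_on with
  | empty =>
    exact ⟨fun _ => Classical.arbitrary ι, fun f => ⟨measurable_const, ⟨_, fun _ => le_rfl⟩,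
      by simp⟩⟩
  | insert a s ha ih =>
    obtain ⟨σ, hσ⟩ := ih
    have hT : 0 ≤ ∑ i ∈ s, w i := Finset.sum_nonneg fun i _ => hw i
    set T := ∑ i ∈ s, w i
    -- The time slots are laid end to end; the new index `a` occupies the slot of length `w a` after
    -- `T`.
    refine ⟨fun t => if t ≤ T then σ t else a, fun f => ?_⟩
    obtain ⟨hm, ⟨r, hr⟩, hint⟩ := hσ f
    have hm' : Measurable fun t => f (if t ≤ T then σ t else a) := by
      have : (fun t => f (if t ≤ T then σ t else a)) = fun t => if t ≤ T then f (σ t) else f a := by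
        ext t
        split_ifs <;> rfl
      rw [this]
      exact Measurable.ite measurableSet_Iic hm measurable_const
    have hb : ∀ t, |f (if t ≤ T then σ t else a)| ≤ max r |f a| := by
      intro t
      split_ifs
      · exact (hr t).trans (le_max_left _ _)
      · exact le_max_right _ _
    have hii : ∀ x y : ℝ, IntervalIntegrable (fun t => f (if t ≤ T then σ t else a))
        MeasureTheory.volume x y := fun x y =>
      (intervalIntegrable_const (c := max r |f a|)).mono_fun hm'.aestronglyMeasurable
        (Filter.Eventually.of_forall fun t => by
          simpa only [Real.norm_eq_abs] using (hb t).trans (le_abs_self _))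
    refine ⟨hm', ⟨_, hb⟩, ?_⟩
    rw [Finset.sum_insert ha, Finset.sum_insert ha, add_comm (w a),
      ← intervalIntegral.integral_add_adjacent_intervals (hii 0 T) (hii T (T + w a)), ← hint,
      add_comm (w a * f a)]
    congr 1
    · refine intervalIntegral.integral_congr fun t ht => ?_
      rw [Set.uIcc_of_le hT] at ht
      simp only [if_pos ht.2]
    · rw [intervalIntegral.integral_congr_ae (g := fun _ => f a)
        (Filter.Eventually.of_forall fun t ht => ?_)]
      · simp
      · rw [Set.uIoc_of_le (le_add_of_nonneg_right (hw a))] at ht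
        simp only [if_neg (not_le.2 ht.1)]

theorem Equiv.Perm.permMatrix_mul_diagonal_mul_transpose {n : Type*} [Fintype n] [DecidableEq n]
    (σ : Equiv.Perm n) (d : n → ℝ) :
    σ.permMatrix ℝ * Matrix.diagonal d * (σ.permMatrix ℝ).transpose =
      Matrix.diagonal fun i => d (σ i) := by
  ext i j
  rw [Matrix.mul_apply]
  simp only [Matrix.mul_diagonal, Equiv.Perm.permMatrix, Matrix.transpose_apply,
    PEquiv.toMatrix_apply, Equiv.toPEquiv_apply, Option.mem_def, Option.some.injEq, ite_mul,
    one_mul, zero_mul, Finset.sum_ite_eq, Finset.mem_univ, if_true]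
  rw [Matrix.diagonal_apply]
  simp [eq_comm]

open MeasureTheory in
/-- A matrix whose logarithmic spectrum satisfies the majorization constraint is reached by
switching between the permutations of the spectrum of `D` in its own eigenbasis. -/
theorem mem_reachableSet_of_isMajorizedBy {n : ℕ} {D : Matrix (Fin n) (Fin n) ℝ}
    (hD : D.IsHermitian) {T : ℝ} (hT : 0 ≤ T) {c : ℝ} (hc : 0 < c) {S₁ : Matrix (Fin n) (Fin n) ℝ}
    (hS : S₁.PosDef)
    (hmaj : IsMajorizedBy (fun i => Real.log (hS.isHermitian.eigenvalues i))
      (fun i => Real.log c + 2 * T * hD.eigenvalues i)) :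
    S₁ ∈ reachableSet (c • (1 : Matrix (Fin n) (Fin n) ℝ)) D T := by
  obtain ⟨w, hw, hw1, hx⟩ := hmaj.exists_convex_combination
  obtain ⟨σ, hσ⟩ := exists_measurable_occupation Finset.univ (fun τ => T * w τ)
    fun τ => mul_nonneg hT (hw τ)
  rw [← Finset.mul_sum, hw1, mul_one] at hσ
  obtain ⟨Q, hQ, hQ', hSQ⟩ := hS.isHermitian.exists_orthogonal_diagonalization
  obtain ⟨R, hR, hR', hDR⟩ := hD.exists_orthogonal_diagonalization
  set d := hD.eigenvalues
  -- This control carries the eigenbasis `R` of `D` to the eigenbasis `Q` of the target, permuted by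
  -- `σ t`. The equation then decouples into `x i' = 2 * g i t * x i`, solved explicitly below.
  let U : ℝ → Matrix (Fin n) (Fin n) ℝ := fun t => Q * (σ t).permMatrix ℝ * R.transpose
  let g : Fin n → ℝ → ℝ := fun i t => d (σ t i)
  let I : Fin n → ℝ → ℝ := fun i t => ∫ s in (0 : ℝ)..t, g i s
  let x : Fin n → ℝ → ℝ := fun i t => c * Real.exp (2 * I i t)
  let S : ℝ → Matrix (Fin n) (Fin n) ℝ := fun t =>
    Q * Matrix.diagonal (fun i => x i t) * Q.transpose
  have hg : ∀ i, IntervalIntegrable (g i) volume 0 T := by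
    intro i
    obtain ⟨hm, ⟨r, hr⟩, -⟩ := hσ fun τ => d (τ i)
    exact (intervalIntegrable_const (c := r)).mono_fun hm.aestronglyMeasurable
      (Filter.Eventually.of_forall fun t => by
        simpa only [Real.norm_eq_abs] using (hr t).trans (le_abs_self _))
  have hI : ∀ i, AbsolutelyContinuousOnInterval (I i) 0 T := fun i =>
    (hg i).absolutelyContinuousOnInterval_intervalIntegral (by simp)
  have hentry : ∀ (y : Fin n → ℝ) i j,
      (Q * Matrix.diagonal y * Q.transpose) i j = ∑ l, Q i l * Q j l * y l := by
    intro y i j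
    rw [Matrix.mul_apply]
    refine Finset.sum_congr rfl fun l _ => ?_
    rw [Matrix.mul_diagonal, Matrix.transpose_apply]
    ring
  have hperm : ∀ t, U t * D * (U t).transpose = Q * Matrix.diagonal (fun i => g i t) * Q.transpose := by
    intro t
    have h1 : U t * R = Q * (σ t).permMatrix ℝ := by
      simp only [U]
      rw [Matrix.mul_assoc, hR, Matrix.mul_one]
    calc U t * D * (U t).transpose
        = (U t * R) * Matrix.diagonal d * (U t * R).transpose := by
          conv_lhs => rw [hDR]
          simp only [Matrix.transpose_mul, Matrix.mul_assoc]
      _ = Q * ((σ t).permMatrix ℝ * Matrix.diagonal d * ((σ t).permMatrix ℝ).transpose) *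
            Q.transpose := by
          rw [h1, Matrix.transpose_mul]
          simp only [Matrix.mul_assoc]
      _ = _ := by rw [Equiv.Perm.permMatrix_mul_diagonal_mul_transpose]
  have hxac : ∀ i, AbsolutelyContinuousOnInterval (x i) 0 T := by
    intro i
    obtain ⟨r, hr⟩ := (hI i).exists_bound
    have hcd : ContDiff ℝ 1 fun y : ℝ => c * Real.exp (2 * y) := by fun_prop
    obtain ⟨K, hK⟩ := hcd.contDiffOn.exists_lipschitzOnWith (by decide)
      (convex_Icc (-r) r) isCompact_Icc
    refine AbsolutelyContinuousOnInterval.of_abs_sub_le (ι := Unit) (K := K)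
      (fun _ => hI i) fun s hs t ht => ?_
    have := hK.dist_le_mul _ (abs_le.1 (hr s hs)) _ (abs_le.1 (hr t ht))
    simpa [Real.dist_eq] using this
  refine ⟨hS, U, S, fun t _ => ?_, fun i j => ?_, ⟨fun i j => ?_, ?_⟩, ?_, ?_⟩
  · rw [Matrix.mem_orthogonalGroup_iff]
    have hP : (σ t).permMatrix ℝ * ((σ t).permMatrix ℝ).transpose = 1 := by
      have := Equiv.Perm.permMatrix_mul_diagonal_mul_transpose (σ t) fun _ => (1 : ℝ)
      simpa using this
    calc U t * (U t).transpose
        = Q * ((σ t).permMatrix ℝ * (R.transpose * R) * ((σ t).permMatrix ℝ).transpose) *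
            Q.transpose := by
          simp only [U, Matrix.transpose_mul, Matrix.transpose_transpose, Matrix.mul_assoc]
      _ = 1 := by rw [hR, Matrix.mul_one, hP, Matrix.mul_one, hQ']
  · exact (hσ fun τ => (Q * τ.permMatrix ℝ * R.transpose) i j).1
  · simp only [S, hentry]
    refine AbsolutelyContinuousOnInterval.of_abs_sub_le (K := 1)
      (fun l => (hxac l).const_mul (Q i l * Q j l)) fun s _ t _ => ?_
    rw [one_mul, ← Finset.sum_sub_distrib]
    exact Finset.abs_sum_le_sum_abs _ _
  · have hae : ∀ᵐ t ∂(volume.restrict (Set.Icc 0 T)), ∀ i, HasDerivAt (I i) (g i t) t := by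
      rw [ae_all_iff]
      intro i
      filter_upwards [ae_restrict_of_ae (s := Set.Icc 0 T) (hg i).ae_hasDerivAt_integral,
        ae_restrict_mem measurableSet_Icc] with t ht htm
      exact ht (Set.uIcc_of_le hT ▸ htm) 0 (by simp)
    filter_upwards [hae] with t ht i j
    have hx' : ∀ l, HasDerivAt (x l) (2 * g l t * x l t) t := fun l =>
      ((((ht l).const_mul 2).exp).const_mul c).congr_deriv (by simp only [x]; ring)
    have hmul : U t * D * (U t).transpose * S t + S t * (U t * D * (U t).transpose) =
        Q * Matrix.diagonal (fun l => 2 * g l t * x l t) * Q.transpose := by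
      have hprod : ∀ y z : Fin n → ℝ, Q * Matrix.diagonal y * Q.transpose *
          (Q * Matrix.diagonal z * Q.transpose) =
            Q * Matrix.diagonal (fun l => y l * z l) * Q.transpose := by
        intro y z
        rw [← Matrix.diagonal_mul_diagonal]
        calc _ = Q * Matrix.diagonal y * (Q.transpose * Q) * Matrix.diagonal z * Q.transpose := by
              simp only [Matrix.mul_assoc]
          _ = _ := by rw [hQ, Matrix.mul_one]; simp only [Matrix.mul_assoc]
      rw [hperm]
      simp only [S]
      rw [hprod, hprod, ← Matrix.add_mul, ← Matrix.mul_add, Matrix.diagonal_add]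
      congr 3
      ext l
      ring
    rw [hmul]
    simp only [S, hentry]
    exact HasDerivAt.fun_sum fun l _ => (hx' l).const_mul _
  · have : (fun i => x i 0) = fun _ => c := by
      ext i
      simp [x, I]
    simp only [S, this]
    rw [← Matrix.smul_one_eq_diagonal, Matrix.mul_smul, Matrix.mul_one, Matrix.smul_mul, hQ']
  · have : (fun i => x i T) = hS.isHermitian.eigenvalues := by
      ext i
      have h1 : I i T = ∑ τ : Equiv.Perm (Fin n), T * w τ * d (τ i) := (hσ fun τ => d (τ i)).2.2
      -- Rado's combination read as a time integral; the constant `log c` is unaffected because the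
      -- weights sum to `1`.
      have h2 : Real.log (hS.isHermitian.eigenvalues i) = Real.log c + 2 * I i T := by
        rw [hx i, h1, Finset.mul_sum]
        conv_rhs => rw [← one_mul (Real.log c), ← hw1, Finset.sum_mul, ← Finset.sum_add_distrib]
        exact Finset.sum_congr rfl fun τ _ => by ring
      simp only [x]
      rw [← Real.exp_log (hS.eigenvalues_pos i), h2, Real.exp_add, Real.exp_log hc]
    simp only [S, this]
    exact hSQ.symm

/-! ### The characterization of the reachable set -/

theorem hasSpectrumOn_conj {n : ℕ} {D : Matrix (Fin n) (Fin n) ℝ} (hD : D.IsHermitian) {T : ℝ}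
    {U : ℝ → Matrix (Fin n) (Fin n) ℝ}
    (hU : ∀ t ∈ Set.Icc 0 T, U t ∈ Matrix.orthogonalGroup (Fin n) ℝ) :
    HasSpectrumOn (fun t => U t * D * (U t).transpose) hD.eigenvalues T := by
  intro t ht
  obtain ⟨R, hR, hR', hDR⟩ := hD.exists_orthogonal_diagonalization
  have h1 := (Matrix.mem_orthogonalGroup_iff' (Fin n) ℝ).1 (hU t ht)
  have h2 := (Matrix.mem_orthogonalGroup_iff (Fin n) ℝ).1 (hU t ht)
  refine ⟨U t * R, ?_, ?_, ?_⟩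
  · rw [Matrix.transpose_mul, Matrix.mul_assoc, ← Matrix.mul_assoc (U t).transpose, h1,
      Matrix.one_mul, hR]
  · rw [Matrix.transpose_mul, Matrix.mul_assoc, ← Matrix.mul_assoc R, hR', Matrix.one_mul, h2]
  · simp only [Matrix.transpose_mul]
    conv_lhs => rw [hDR]
    simp only [Matrix.mul_assoc]

theorem theorem2 (n : ℕ) (D : Matrix (Fin n) (Fin n) ℝ) (hD : D.IsDiag) (T : ℝ) (hT : 0 ≤ T)
    (c : ℝ) (hc : 0 < c) :
    reachableSet (c • (1 : Matrix (Fin n) (Fin n) ℝ)) D T =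
      {S | ∃ hS : S.PosDef,
        IsMajorizedBy (fun i => Real.log (hS.isHermitian.eigenvalues i))
          (fun i => Real.log c + 2 * T * (isHermitian_of_isDiag hD).eigenvalues i)} := by
  ext S₁
  constructor
  · rintro ⟨hpos, U, S, hU, -, hS, h0, rfl⟩
    exact ⟨hpos, hS.isMajorizedBy hT (hasSpectrumOn_conj (isHermitian_of_isDiag hD) hU) hc h0 hpos⟩
  · rintro ⟨hpos, hmaj⟩
    exact mem_reachableSet_of_isMajorizedBy _ hT hc hpos hmaj
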